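/- Let $(R,\mathfrak m,k)$ be a (Noetherian) Cohen–Macaulay local ring of Krull dimension one, with total ring of fractions $Q$, and let $I$ be an $\mathfrak m$-primary ideal of $R$. For a finitely generated $R$-module $M$ write $\operatorname{type}(M)=\dim_k\operatorname{Ext}^{\dim M}_R(k,M)$. For ideals $J,L$ of $R$ write $J:L=\{r\in R : rL\subseteq J\}$ and $J:_Q L=\{q\in Q : qL\subseteq J\}$; NZD means non-zerodivisor. A canonical ideal of $R$ is an ideal that, as an $R$-module, is a canonical module of $R$, i.e. a maximal Cohen–Macaulay module of type $1$ and of finite injective dimension. Then $\operatorname{type}(I)\ge\operatorname{type}(R/I)$, and the following are equivalent: 1. $\operatorname{type}(I)=\operatorname{type}(R/I)$ (that is, $I$ is Elias); 2. $xI:\mathfrak m\subseteq (x)$ for every NZD $x\in\mathfrak m$; 3. $xI:\mathfrak m= x(I:\mathfrak m)$ for every NZD $x\in\mathfrak m$; 4. $xI:\mathfrak m\subseteq (x)$ for some NZD $x\in\mathfrak m$; 5. $xI:\mathfrak m= x(I:\mathfrak m)$ for some NZD $x\in\mathfrak m$; 6. $I:_Q\mathfrak m\subseteq R$. Moreover,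 if $K$ is any canonical ideal of $R$, then these conditions are also equivalent to 7. $K\subseteq \mathfrak m\,(K:_Q I)$. -/

import Mathlib

universe u v

open IsLocalRing CategoryTheory

noncomputable section

namespace EliasIdeals

/-- The `R`-module `Ext^n_R(k, M)`, where `k` is the residue field of the local ring `R`. -/
abbrev ExtResidue (R : Type u) [CommRing R] [IsLocalRing R]
    (M : Type u) [AddCommGroup M] [Module R M] (n : ℕ) : Type u :=
  Abelian.Ext.{u} (ModuleCat.of R (ResidueField R)) (ModuleCat.of R M) n

/-- `Ext^n_R(k, M)` is killed by the maximal ideal. -/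
theorem extResidue_isTorsionBySet (R : Type u) [CommRing R] [IsLocalRing R]
    (M : Type u) [AddCommGroup M] [Module R M] (n : ℕ) :
    Module.IsTorsionBySet R (ExtResidue R M n) (maximalIdeal R : Set R) := by
  rintro e ⟨r, hr⟩
  have h0 : r • 𝟙 (ModuleCat.of R (ResidueField R)) = 0 := by
    ext y
    have h : algebraMap R (ResidueField R) r = 0 := (residue_eq_zero_iff r).mpr hr
    have h2 : ∀ z : ResidueField R, r • z = 0 := fun z => by
      rw [Algebra.smul_def, h, zero_mul]
    exact h2 _
  change r • e = 0
  calc r • e = r • (Abelian.Ext.mk₀ (𝟙 _)).comp e (zero_add n) := by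
        rw [Abelian.Ext.mk₀_id_comp]
    _ = 0 := by
        rw [← Abelian.Ext.smul_comp, ← Abelian.Ext.mk₀_smul, h0, Abelian.Ext.mk₀_zero,
          Abelian.Ext.zero_comp]

/-- The `k`-vector space structure on `Ext^n_R(k, M)` induced by its `R`-module structure. -/
instance extResidueModule (R : Type u) [CommRing R] [IsLocalRing R]
    (M : Type u) [AddCommGroup M] [Module R M] (n : ℕ) :
    Module (ResidueField R) (ExtResidue R M n) :=
  letI : Module (R ⧸ maximalIdeal R) (ExtResidue R M n) :=
    (extResidue_isTorsionBySet R M n).module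
  inferInstanceAs (Module (R ⧸ maximalIdeal R) (ExtResidue R M n))

/-- The `k`-vector space structure is compatible with the `R`-module structure. -/
theorem residue_smul_ext {R : Type u} [CommRing R] [IsLocalRing R]
    {M : Type u} [AddCommGroup M] [Module R M] {n : ℕ} (r : R) (e : ExtResidue R M n) :
    residue R r • e = r • e :=
  rfl

/-- The Krull dimension of a nonzero finitely generated module over a Noetherian local ring, as a
natural number (the value `0` is used when the dimension is `⊥` or `⊤`). -/
def moduleDim (R : Type u) [CommRing R] (M : Type u) [AddCommGroup M] [Module R M] : ℕ :=
  ((Module.supportDim R M).unbotD 0).toNat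

/-- The Cohen-Macaulay type `dim_k Ext^{dim M}_R(k, M)`. -/
def cmType (R : Type u) [CommRing R] [IsLocalRing R]
    (M : Type u) [AddCommGroup M] [Module R M] : Cardinal.{u} :=
  Module.rank (ResidueField R) (ExtResidue R M (moduleDim R M))

/-- A maximal Cohen-Macaulay module over a Noetherian local ring: a finitely generated module `M`
admitting an `M`-regular sequence of length `dim R`. -/
def IsMaximalCM (R : Type u) [CommRing R] (M : Type u) [AddCommGroup M] [Module R M] : Prop :=
  Module.Finite R M ∧
    ∃ rs : List R, RingTheory.Sequence.IsRegular M rs ∧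
      (rs.length : WithBot ℕ∞) = ringKrullDim R

/-- A Cohen-Macaulay local ring: a Noetherian local ring with a regular sequence of length equal
to its Krull dimension. -/
def IsCMLocalRing (R : Type u) [CommRing R] : Prop :=
  IsLocalRing R ∧ IsNoetherianRing R ∧ IsMaximalCM R R

/-- A canonical module of a Cohen-Macaulay local ring: a maximal Cohen-Macaulay module of type `1`
and of finite injective dimension. -/
def IsCanonicalModule (R : Type u) [CommRing R] [IsLocalRing R]
    (C : Type u) [AddCommGroup C] [Module R C] : Prop :=
  IsMaximalCM R C ∧ cmType R C = 1 ∧ ∃ n : ℕ, HasInjectiveDimensionLE (ModuleCat.of R C) n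

/-- A canonical ideal: an ideal that is, as a module, a canonical module. -/
def IsCanonicalIdeal {R : Type u} [CommRing R] [IsLocalRing R] (K : Ideal R) : Prop :=
  IsCanonicalModule R K

/-- `I` is primary to the maximal ideal. -/
def IsMaximalPrimary {R : Type u} [CommRing R] [IsLocalRing R] (I : Ideal R) : Prop :=
  I.IsPrimary ∧ I.radical = maximalIdeal R

/-- The colon ideal `J :_R 𝔪`. -/
def colonMax {R : Type u} [CommRing R] [IsLocalRing R] (J : Ideal R) : Ideal R :=
  Submodule.colon J (maximalIdeal R : Set R)

/-- The colon `I :_Q J = {q ∈ Q | q J ⊆ I}` of two ideals of `R` in an `R`-algebra `Q`. -/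
def colonIn {R : Type u} [CommRing R] (Q : Type v) [CommRing Q] [Algebra R Q]
    (I J : Ideal R) : Submodule R Q :=
  IsLocalization.coeSubmodule Q I / IsLocalization.coeSubmodule Q J

theorem mem_colonMax {R : Type u} [CommRing R] [IsLocalRing R] {J : Ideal R} {r : R} :
    r ∈ colonMax J ↔ ∀ y ∈ maximalIdeal R, r * y ∈ J :=
  Submodule.mem_colon

theorem mem_colonIn {R : Type u} [CommRing R] (Q : Type v) [CommRing Q] [Algebra R Q]
    {I J : Ideal R} {q : Q} :
    q ∈ colonIn Q I J ↔ ∀ y ∈ J, ∃ z ∈ I, algebraMap R Q z = q * algebraMap R Q y := by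
  simp [colonIn, Submodule.mem_div_iff_forall_mul_mem]

end EliasIdeals

end

/-!
Let `x ∈ 𝔪` be a nonzerodivisor and `k = R/𝔪`.

**Types.** Since `Hom(k, R) = 0`, the sequence `0 → I → R → R/I → 0` gives an injective connecting
map `Hom(k, R/I) → Ext^1(k, I)`, whence `type(R/I) ≤ type(I)`; these are finite-dimensional
`k`-spaces, so equality holds exactly when `Ext^1(k, I) → Ext^1(k, R)` vanishes. As `x` kills
`Ext^1(k, -)`, this map is identified, through multiplication by `x` on `I` and on `R`, with
`Hom(k, I/xI) → Hom(k, R/xR)`. The socle of `I/xI` is `(xI : 𝔪)/xI`, so the map vanishes exactly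
when `xI : 𝔪 ⊆ (x)` (`connecting_surjective_iff_colonMax_le`). Dividing by `x` turns this into
`I :_Q 𝔪 ⊆ R`, a condition which no longer involves `x`.

**The canonical ideal.** The only property of `K` that matters is duality: `K : (K : J) = J` for
every fractional ideal `J` containing a nonzerodivisor. Granting it, `K ⊆ 𝔪(K : I)` is equivalent
to `K : 𝔪(K : I) ⊆ K : K = R`, and `K : 𝔪(K : I) = (K : (K : I)) : 𝔪 = I : 𝔪`.

Duality follows once the inclusion of an ideal `A` in a strictly larger ideal `B` never induces a
surjection `Hom(B, K) → Hom(A, K)` (`exists_linearMap_not_extending`): apply this to multiples of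
`J` and of `K : (K : J)`, which have the same dual. For modules `N` of finite length,
finite injective dimension implies `Ext^2(N, K) = 0`, by descending induction from high degrees
using that `k` embeds in `R/x`, a module of projective dimension one
(`subsingleton_ext_of_hasInjectiveDimensionLE`). Hence `Ext^1(B, K) = 0`, the cokernel of
`Hom(B, K) → Hom(A, K)` is `Ext^1(B/A, K)`, and it surjects onto `Ext^1(k, K)`, which is nonzero
because `K` has type one. The same property shows that `K` contains a nonzerodivisor.
-/

namespace EliasIdeals

/-! ### Nonzerodivisors in dimension one -/

theorem exact_mulLeft_mkQ {R : Type u} [CommRing R] (x : R) : Function.Exact (LinearMap.mulLeft R x)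
    (Submodule.mkQ (Ideal.span {x})) := by
  rw [LinearMap.exact_iff, Submodule.ker_mkQ]
  ext y
  simp [Ideal.mem_span_singleton', mul_comm]

theorem mulLeft_injective_of_mem_nonZeroDivisors {R : Type u} [CommRing R] {x : R}
    (hx : x ∈ nonZeroDivisors R) :
    Function.Injective (LinearMap.mulLeft R x) := by
  intro a b hab
  exact (mul_cancel_left_mem_nonZeroDivisors hx).mp hab

section Ring

variable {R : Type u} [CommRing R] [IsLocalRing R]

theorem IsCMLocalRing.exists_mem_nonZeroDivisors (hCM : IsCMLocalRing R)
    (hdim : ringKrullDim R = 1) : ∃ x ∈ maximalIdeal R, x ∈ nonZeroDivisors R := by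
  obtain ⟨-, -, -, rs, hrs, hlen⟩ := hCM
  rw [hdim] at hlen
  obtain ⟨x, rfl⟩ := List.length_eq_one_iff.mp (by exact_mod_cast hlen : rs.length = 1)
  refine ⟨x, ?_, ?_⟩
  · by_contra hx
    have hu : IsUnit x := by simpa using hx
    exact hrs.top_ne_smul (by simp [Ideal.span_singleton_eq_top.mpr hu])
  · have h := ((RingTheory.Sequence.isRegular_cons_iff R x []).mp hrs).1
    refine mem_nonZeroDivisors_iff_right.mpr fun y hy => h ?_
    simpa [mul_comm] using hy

/-- In a one-dimensional local ring the ideal generated by a nonzerodivisor contains a power of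
the maximal ideal: no minimal prime contains the nonzerodivisor. -/
theorem exists_maximalIdeal_pow_le [IsNoetherianRing R] (hdim : ringKrullDim R = 1)
    {A : Ideal R} (hA : ∃ y ∈ A, y ∈ nonZeroDivisors R) : ∃ t : ℕ, maximalIdeal R ^ t ≤ A := by
  obtain ⟨y, hyA, hy⟩ := hA
  refine Ideal.exists_pow_le_of_le_radical_of_fg_radical ?_ (IsNoetherian.noetherian _)
  rw [Ideal.radical_eq_sInf]
  refine le_sInf fun p hp => ?_
  have hp' : p.IsPrime := hp.2
  have h1 : Ring.KrullDimLE 1 R := Ring.krullDimLE_iff.mpr (by simp [hdim])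
  rcases Ring.krullDimLE_one_iff.mp h1 p hp' with h | h
  · exact ((Set.disjoint_left.mp (Ideal.disjoint_nonZeroDivisors_of_mem_minimalPrimes h))
      (hp.1 hyA) hy).elim
  · exact (IsLocalRing.eq_maximalIdeal h).ge

theorem IsMaximalPrimary.exists_mem_nonZeroDivisors [IsNoetherianRing R] {I : Ideal R}
    (hI : IsMaximalPrimary I) (hx : ∃ x ∈ maximalIdeal R, x ∈ nonZeroDivisors R) :
    ∃ y ∈ I, y ∈ nonZeroDivisors R := by
  obtain ⟨x, hxm, hx⟩ := hx
  obtain ⟨t, ht⟩ := Ideal.exists_pow_le_of_le_radical_of_fg_radical hI.2.ge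
    (IsNoetherian.noetherian _)
  exact ⟨x ^ t, ht (Ideal.pow_mem_pow hxm t), pow_mem hx t⟩

end Ring

/-! ### Vanishing of `Ext` along short exact sequences -/

section Ext

open Abelian

variable {R : Type u} [CommRing R] {A B C : Type u} [AddCommGroup A] [Module R A]
  [AddCommGroup B] [Module R B] [AddCommGroup C] [Module R C] {f : A →ₗ[R] B} {g : B →ₗ[R] C}

theorem shortExact_of_exact (hfg : Function.Exact f g) (hf : Function.Injective f)
    (hg : Function.Surjective g) :
    (ModuleCat.shortComplexOfCompEqZero f g hfg.linearMap_comp_eq_zero).ShortExact :=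
  ModuleCat.shortComplex_shortExact _ hfg hf hg

variable (M : ModuleCat.{u} R) {n : ℕ}

theorem subsingleton_ext_middle (hfg : Function.Exact f g) (hf : Function.Injective f)
    (hg : Function.Surjective g) (hA : Subsingleton (Ext.{u} (ModuleCat.of R A) M n))
    (hC : Subsingleton (Ext.{u} (ModuleCat.of R C) M n)) :
    Subsingleton (Ext.{u} (ModuleCat.of R B) M n) := by
  refine subsingleton_of_forall_eq 0 fun e => ?_
  obtain ⟨e', rfl⟩ := Ext.contravariant_sequence_exact₂ (shortExact_of_exact hfg hf hg) M e
    (hA.elim _ _)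
  rw [hC.elim e' 0, Ext.comp_zero]

theorem subsingleton_ext_left (hfg : Function.Exact f g) (hf : Function.Injective f)
    (hg : Function.Surjective g) (hB : Subsingleton (Ext.{u} (ModuleCat.of R B) M n))
    (hC : Subsingleton (Ext.{u} (ModuleCat.of R C) M (n + 1))) :
    Subsingleton (Ext.{u} (ModuleCat.of R A) M n) := by
  refine subsingleton_of_forall_eq 0 fun e => ?_
  obtain ⟨e', rfl⟩ := Ext.contravariant_sequence_exact₁ (shortExact_of_exact hfg hf hg) M e
    (add_comm 1 n) (hC.elim _ _)
  rw [hB.elim e' 0, Ext.comp_zero]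

theorem subsingleton_ext_right (hfg : Function.Exact f g) (hf : Function.Injective f)
    (hg : Function.Surjective g) (hA : Subsingleton (Ext.{u} (ModuleCat.of R A) M n))
    (hB : Subsingleton (Ext.{u} (ModuleCat.of R B) M (n + 1))) :
    Subsingleton (Ext.{u} (ModuleCat.of R C) M (n + 1)) := by
  refine subsingleton_of_forall_eq 0 fun e => ?_
  obtain ⟨e', rfl⟩ := Ext.contravariant_sequence_exact₃ (shortExact_of_exact hfg hf hg) M e
    (hB.elim _ _) (add_comm 1 n)
  rw [hA.elim e' 0, Ext.comp_zero]

theorem subsingleton_ext_of_linearEquiv (e : A ≃ₗ[R] B)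
    (hB : Subsingleton (Ext.{u} (ModuleCat.of R B) M n)) :
    Subsingleton (Ext.{u} (ModuleCat.of R A) M n) := by
  refine subsingleton_of_forall_eq 0 fun a => ?_
  have h : a = (Ext.mk₀ e.toModuleIso.hom).comp
      ((Ext.mk₀ e.toModuleIso.inv).comp a (zero_add n)) (zero_add n) := by
    rw [Ext.mk₀_comp_mk₀_assoc, Iso.hom_inv_id, Ext.mk₀_id_comp]
  rw [h, hB.elim ((Ext.mk₀ e.toModuleIso.inv).comp a (zero_add n)) 0, Ext.comp_zero]

theorem subsingleton_ext_of_projective (P : Type u) [AddCommGroup P] [Module R P]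
    [Module.Projective R P] (n : ℕ) :
    Subsingleton (Ext.{u} (ModuleCat.of R P) M (n + 1)) :=
  subsingleton_of_forall_eq 0 fun e => e.eq_zero_of_projective

end Ext

/-! ### Modules of finite injective dimension -/

section FiniteInjectiveDimension

open Abelian

variable {R : Type u} [CommRing R] [IsLocalRing R] [IsNoetherianRing R]

/-- If `Ext^n(k, M)` vanishes, then so does `Ext^n(N, M)` for every finitely generated `N` killed
by a power of the maximal ideal, because `N` has a filtration with all quotients `k`. -/
theorem subsingleton_ext_of_residue (M : ModuleCat.{u} R) {n : ℕ}
    (hk : Subsingleton (ExtResidue R M n)) (N : Type u) [AddCommGroup N] [Module R N]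
    [hfin : Module.Finite R N] (hN : ∃ t : ℕ, maximalIdeal R ^ t ≤ Module.annihilator R N) :
    Subsingleton (Ext.{u} (ModuleCat.of R N) M n) := by
  induction hfin using IsNoetherianRing.induction_on_isQuotientEquivQuotientPrime R with
  | subsingleton N =>
    refine subsingleton_of_forall_eq 0 fun e => ?_
    have hz : 𝟙 (ModuleCat.of R N) = 0 := by
      ext y
      exact Subsingleton.elim (α := N) _ _
    rw [← Ext.mk₀_id_comp e, hz, Ext.mk₀_zero, Ext.zero_comp]
  | quotient N p e =>
    obtain ⟨t, ht⟩ := hN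
    rw [e.annihilator_eq, Ideal.annihilator_quotient] at ht
    have hp : p.asIdeal = maximalIdeal R :=
      le_antisymm (IsLocalRing.le_maximalIdeal p.2.ne_top) (p.2.le_of_pow_le ht)
    refine subsingleton_ext_of_linearEquiv M
      (e.trans (Submodule.quotEquivOfEq _ _ hp) : N ≃ₗ[R] ResidueField R) hk
  | exact N₁ N₂ N₃ f g hf hg hfg h₁ h₃ =>
    obtain ⟨t, ht⟩ := hN
    exact subsingleton_ext_middle M hfg hf hg
      (h₁ ⟨t, ht.trans (f.annihilator_le_of_injective hf)⟩)
      (h₃ ⟨t, ht.trans (g.annihilator_le_of_surjective hg)⟩)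

/-- A nonzero module killed by a power of the maximal ideal contains a copy of `k`. -/
theorem exists_residueField_injective (N : Type u) [AddCommGroup N] [Module R N] [Nontrivial N]
    (hN : ∃ t : ℕ, maximalIdeal R ^ t ≤ Module.annihilator R N) :
    ∃ f : ResidueField R →ₗ[R] N, Function.Injective f := by
  obtain ⟨p, hp⟩ := associatedPrimes.nonempty R N
  obtain ⟨t, ht⟩ := hN
  obtain ⟨hprime, f, hf⟩ :=
    (isAssociatedPrime_iff_exists_injective_linearMap p N).mp hp
  have h : p = maximalIdeal R := by
    refine le_antisymm (IsLocalRing.le_maximalIdeal hprime.ne_top) (hprime.le_of_pow_le (n := t) ?_)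
    have := ht.trans (f.annihilator_le_of_injective hf)
    rwa [Ideal.annihilator_quotient] at this
  subst h
  exact ⟨f, hf⟩

/-- Over a one-dimensional ring of positive depth, a module of finite injective dimension has
`Ext^i(N, M) = 0` for `i ≥ 2` and `N` of finite length. By descending induction on `i` it suffices
to treat `N = k`, which embeds in `R/x`; the latter has projective dimension one. -/
theorem subsingleton_ext_of_hasInjectiveDimensionLE (hdim : ringKrullDim R = 1)
    (hx : ∃ x ∈ maximalIdeal R, x ∈ nonZeroDivisors R) (M : ModuleCat.{u} R)
    (hM : ∃ n : ℕ, HasInjectiveDimensionLE M n) (i : ℕ) (N : Type u) [AddCommGroup N] [Module R N]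
    [Module.Finite R N] (hN : ∃ t : ℕ, maximalIdeal R ^ t ≤ Module.annihilator R N) :
    Subsingleton (Ext.{u} (ModuleCat.of R N) M (i + 2)) := by
  obtain ⟨n, hn⟩ := hM
  obtain ⟨x, hxm, hx⟩ := hx
  induction h : n - i generalizing i N with
  | zero => exact HasInjectiveDimensionLT.subsingleton M (n + 1) (i + 2) (by omega) _
  | succ d ih =>
    refine subsingleton_ext_of_residue M ?_ N hN
    have hann : ∃ t : ℕ, maximalIdeal R ^ t ≤ Module.annihilator R (R ⧸ Ideal.span {x}) := by
      rw [Ideal.annihilator_quotient]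
      exact exists_maximalIdeal_pow_le hdim ⟨x, Ideal.mem_span_singleton_self x, hx⟩
    have : Nontrivial (R ⧸ Ideal.span {x}) := Ideal.Quotient.nontrivial_iff.mpr
      (by simpa [Ideal.span_singleton_eq_top] using hxm)
    obtain ⟨f, hf⟩ := exists_residueField_injective (R ⧸ Ideal.span {x}) hann
    obtain ⟨t, ht⟩ := hann
    refine subsingleton_ext_left M (LinearMap.exact_map_mkQ_range f) hf
      (Submodule.mkQ_surjective _) ?_ (ih (i + 1) _
        ⟨t, ht.trans ((LinearMap.range f).mkQ.annihilator_le_of_surjective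
          (Submodule.mkQ_surjective _))⟩ (by omega))
    exact subsingleton_ext_right M (exact_mulLeft_mkQ x)
      (mulLeft_injective_of_mem_nonZeroDivisors hx) (Submodule.mkQ_surjective _)
      (subsingleton_ext_of_projective M R i) (subsingleton_ext_of_projective M R (i + 1))

/-- Let `M` have finite injective dimension with `Ext^1(k, M) ≠ 0`. Then the inclusion of an ideal
`A`, containing a nonzerodivisor, in a strictly larger ideal `B` never induces a surjection
`Hom(B, M) → Hom(A, M)`: its cokernel is `Ext^1(B/A, M)`, which maps onto `Ext^1(k, M)`. -/
theorem exists_linearMap_not_extending (hdim : ringKrullDim R = 1)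
    (hx : ∃ x ∈ maximalIdeal R, x ∈ nonZeroDivisors R) (M : Type u) [AddCommGroup M] [Module R M]
    (hM : ∃ n : ℕ, HasInjectiveDimensionLE (ModuleCat.of R M) n)
    (hk : Nontrivial (ExtResidue R M 1)) {A B : Ideal R} (hAB : A < B)
    (hA : ∃ y ∈ A, y ∈ nonZeroDivisors R) :
    ∃ f : A →ₗ[R] M, ∀ g : B →ₗ[R] M, g ∘ₗ Submodule.inclusion hAB.le ≠ f := by
  by_contra! hext
  have vanish := subsingleton_ext_of_hasInjectiveDimensionLE hdim hx (ModuleCat.of R M) hM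
  obtain ⟨t, ht⟩ := exists_maximalIdeal_pow_le hdim hA
  -- `Ext^1(B, M) = 0`, since `B` is a submodule of `R` with quotient of finite length.
  have hB : Subsingleton (Ext.{u} (ModuleCat.of R B) (ModuleCat.of R M) 1) := by
    refine subsingleton_ext_left (f := B.subtype) (g := B.mkQ) _ ?_ B.injective_subtype
      B.mkQ_surjective (subsingleton_ext_of_projective _ R 0) (vanish 0 _ ⟨t, ?_⟩)
    · rw [LinearMap.exact_iff, Submodule.ker_mkQ, Submodule.range_subtype]
    · rw [Ideal.annihilator_quotient]
      exact ht.trans hAB.le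
  set j : A →ₗ[R] B := Submodule.inclusion hAB.le with hj
  have hjinj : Function.Injective j := Submodule.inclusion_injective hAB.le
  have hE := shortExact_of_exact (LinearMap.exact_map_mkQ_range j) hjinj
    (Submodule.mkQ_surjective _)
  have hN : Subsingleton
      (Ext.{u} (ModuleCat.of R (B ⧸ LinearMap.range j)) (ModuleCat.of R M) 1) := by
    refine subsingleton_of_forall_eq 0 fun e => ?_
    obtain ⟨φ, rfl⟩ := Ext.contravariant_sequence_exact₃ hE _ e (hB.elim _ _) (add_zero 1)
    obtain ⟨φ, rfl⟩ := Ext.homEquiv₀.symm.surjective φ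
    obtain ⟨ψ, hψ⟩ := hext φ.hom
    have hφ : φ = ModuleCat.ofHom j ≫ ModuleCat.ofHom ψ := by
      ext1
      exact hψ.symm
    rw [hφ, Ext.homEquiv₀_symm_apply, ← Ext.mk₀_comp_mk₀]
    exact hE.extClass_comp_assoc _
  have hne : Nontrivial (B ⧸ LinearMap.range j) := by
    rw [Submodule.Quotient.nontrivial_iff, hj, Submodule.range_inclusion]
    intro htop
    refine hAB.not_ge fun b hb => ?_
    have : (⟨b, hb⟩ : B) ∈ Submodule.comap B.subtype A := htop ▸ Submodule.mem_top
    exact this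
  have hann : maximalIdeal R ^ t ≤ Module.annihilator R (B ⧸ LinearMap.range j) := by
    intro r hr
    rw [Module.mem_annihilator]
    intro b
    obtain ⟨b, rfl⟩ := Submodule.mkQ_surjective _ b
    rw [← map_smul, Submodule.mkQ_apply, Submodule.Quotient.mk_eq_zero, hj,
      Submodule.range_inclusion]
    exact A.mul_mem_right _ (ht hr)
  obtain ⟨f, hf⟩ := exists_residueField_injective (B ⧸ LinearMap.range j) ⟨t, hann⟩
  have := subsingleton_ext_left (ModuleCat.of R M) (LinearMap.exact_map_mkQ_range f) hf
    (Submodule.mkQ_surjective _) hN (vanish 0 _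
      ⟨t, hann.trans ((LinearMap.range f).mkQ.annihilator_le_of_surjective
          (Submodule.mkQ_surjective _))⟩)
  exact not_subsingleton _ this

end FiniteInjectiveDimension

/-! ### Dimensions of ideals and their quotients -/

theorem moduleDim_ideal {R : Type u} [CommRing R] (hdim : ringKrullDim R = 1) {I : Ideal R}
    (hI : ∃ y ∈ I, y ∈ nonZeroDivisors R) : moduleDim R I = 1 := by
  obtain ⟨y, hyI, hy⟩ := hI
  have h : Module.supportDim R I = 1 := by
    refine le_antisymm (hdim ▸ Module.supportDim_le_ringKrullDim R I) ?_
    rw [← hdim, ← Module.supportDim_self_eq_ringKrullDim]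
    refine Module.supportDim_le_of_injective
      ((LinearMap.mulLeft R y).codRestrict I fun r => I.mul_mem_right _ hyI) ?_
    exact fun a b hab => mulLeft_injective_of_mem_nonZeroDivisors hy (congrArg Subtype.val hab)
  rw [moduleDim, h]
  rfl

theorem moduleDim_quotient {R : Type u} [CommRing R] [IsLocalRing R]
    (hdim : ringKrullDim R = 1) {I : Ideal R} (hne : I ≠ ⊤)
    (hI : ∃ y ∈ I, y ∈ nonZeroDivisors R) : moduleDim R (R ⧸ I) = 0 := by
  obtain ⟨y, hyI, hy⟩ := hI
  have hym : y ∈ maximalIdeal R := IsLocalRing.le_maximalIdeal hne hyI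
  have h0 : ringKrullDim (R ⧸ Ideal.span {y}) ≤ 0 := by
    have h := ringKrullDim_quotient_succ_le_of_nonZeroDivisor hy
    rw [hdim] at h
    exact ENat.WithBot.add_le_add_one_right_iff.mp (by simpa using h)
  have h : Module.supportDim R (R ⧸ I) ≤ 0 := by
    rw [Module.supportDim_quotient_eq_ringKrullDim]
    exact (ringKrullDim_le_of_surjective (Ideal.Quotient.factor
      ((Ideal.span_singleton_le_iff_mem I).mpr hyI)) (Ideal.Quotient.factor_surjective _)).trans h0
  have : Nontrivial (R ⧸ I) := Ideal.Quotient.nontrivial_iff.mpr hne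
  have h' : Module.supportDim R (R ⧸ I) = 0 := by
    refine le_antisymm h ?_
    rw [Module.supportDim_quotient_eq_ringKrullDim]
    exact ringKrullDim_nonneg_of_nontrivial
  rw [moduleDim, h']
  rfl

theorem IsMaximalCM.moduleDim_eq_one {R : Type u} [CommRing R] [IsLocalRing R]
    [IsNoetherianRing R] (hdim : ringKrullDim R = 1) {M : Type u} [AddCommGroup M]
    [Module R M] (hM : IsMaximalCM R M) : moduleDim R M = 1 := by
  obtain ⟨hfin, rs, hrs, hlen⟩ := hM
  have h : Module.supportDim R M = 1 := by
    refine le_antisymm (hdim ▸ Module.supportDim_le_ringKrullDim R M) ?_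
    rw [← Module.supportDim_add_length_eq_supportDim_of_isRegular rs hrs, hlen, hdim]
    have : Nontrivial (M ⧸ Ideal.ofList rs • (⊤ : Submodule R M)) :=
      Submodule.Quotient.nontrivial_iff.mpr hrs.top_ne_smul.symm
    have h0 : 0 ≤ Module.supportDim R (M ⧸ Ideal.ofList rs • (⊤ : Submodule R M)) := by
      rw [Module.supportDim]
      have := Module.nonempty_support_of_nontrivial
        (R := R) (M := M ⧸ Ideal.ofList rs • (⊤ : Submodule R M))
      have := this.to_subtype
      exact Order.krullDim_nonneg
    simpa using add_le_add_left h0 1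
  rw [moduleDim, h]
  rfl

/-! ### Comparing the types of `I` and `R ⧸ I` -/

section Sequences

variable {R : Type u} [CommRing R]

theorem shortExact_ideal (I : Ideal R) : (ModuleCat.shortComplexOfCompEqZero I.subtype I.mkQ
    (LinearMap.exact_subtype_mkQ I).linearMap_comp_eq_zero).ShortExact :=
  shortExact_of_exact (LinearMap.exact_subtype_mkQ I) I.injective_subtype I.mkQ_surjective

theorem shortExact_smul {M : Type u} [AddCommGroup M] [Module R M] {x : R}
    (hx : Function.Injective (LinearMap.lsmul R M x)) :
    (ModuleCat.shortComplexOfCompEqZero (LinearMap.lsmul R M x)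
      (Submodule.mkQ (LinearMap.range (LinearMap.lsmul R M x)))
      (LinearMap.exact_map_mkQ_range _).linearMap_comp_eq_zero).ShortExact :=
  shortExact_of_exact (LinearMap.exact_map_mkQ_range _) hx (Submodule.mkQ_surjective _)

theorem lsmul_ideal_injective {x : R} (hx : x ∈ nonZeroDivisors R) (I : Ideal R) :
    Function.Injective (LinearMap.lsmul R I x) := fun _ _ hab =>
  Subtype.ext (mulLeft_injective_of_mem_nonZeroDivisors hx (congrArg Subtype.val hab))

theorem lsmul_ring_injective {x : R} (hx : x ∈ nonZeroDivisors R) :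
    Function.Injective (LinearMap.lsmul R R x) :=
  mulLeft_injective_of_mem_nonZeroDivisors hx

/-- The map `I/xI → R/xR` induced by the inclusion of `I`. -/
noncomputable def quotSMulToRing (x : R) (I : Ideal R) :
    (I ⧸ LinearMap.range (LinearMap.lsmul R I x)) →ₗ[R]
      R ⧸ LinearMap.range (LinearMap.lsmul R R x) :=
  Submodule.mapQ _ _ I.subtype <| by
    rintro _ ⟨i, rfl⟩
    exact ⟨i, rfl⟩

theorem quotSMulToRing_mk_eq_zero_iff {x : R} {I : Ideal R} (i : I) :
    quotSMulToRing x I (Submodule.mkQ _ i) = 0 ↔ (i : R) ∈ Ideal.span {x} := by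
  rw [quotSMulToRing, Submodule.mkQ_apply, Submodule.mapQ_apply, Submodule.Quotient.mk_eq_zero,
    Ideal.mem_span_singleton']
  simp [mul_comm]

end Sequences

section TypeComparison

open Abelian

variable {R : Type u} [CommRing R] [IsLocalRing R]

instance extResidue_isScalarTower (M : Type u) [AddCommGroup M] [Module R M] (n : ℕ) :
    IsScalarTower R (ResidueField R) (ExtResidue R M n) where
  smul_assoc r c e := by
    obtain ⟨s, rfl⟩ := residue_surjective c
    rw [Algebra.smul_def, ResidueField.algebraMap_eq, ← map_mul, residue_smul_ext,
      residue_smul_ext, mul_smul]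

theorem extResidue_smul_eq_zero {M : Type u} [AddCommGroup M] [Module R M] {n : ℕ} {r : R}
    (hr : r ∈ maximalIdeal R) (e : ExtResidue R M n) : r • e = 0 :=
  @extResidue_isTorsionBySet R _ _ M _ _ n e ⟨r, hr⟩

theorem residueField_linearMap_ext {M : Type u} [AddCommGroup M] [Module R M]
    {f g : ResidueField R →ₗ[R] M} (h : f 1 = g 1) : f = g := by
  ext c
  obtain ⟨r, rfl⟩ := residue_surjective c
  have : residue R r = r • (1 : ResidueField R) := by
    rw [Algebra.smul_def, ResidueField.algebraMap_eq, mul_one]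
  rw [this, map_smul, map_smul, h]

theorem smul_one_residueField_eq_zero {x : R} (hx : x ∈ maximalIdeal R) :
    x • (1 : ResidueField R) = 0 := by
  rw [Algebra.smul_def, ResidueField.algebraMap_eq, (residue_eq_zero_iff x).mpr hx, zero_mul]

/-- Every linear map `k → R` vanishes when `R` has positive depth. -/
theorem linearMap_residueField_eq_zero {x : R} (hxm : x ∈ maximalIdeal R)
    (hx : x ∈ nonZeroDivisors R) (f : ResidueField R →ₗ[R] R) : f = 0 := by
  refine residueField_linearMap_ext (mulLeft_injective_of_mem_nonZeroDivisors hx ?_)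
  have := f.map_smul x 1
  rw [smul_one_residueField_eq_zero hxm, map_zero] at this
  simpa using this.symm

/-- The connecting map `Hom(k, R/I) → Ext^1(k, I)` of `0 → I → R → R/I → 0`. -/
noncomputable def connecting (I : Ideal R) :
    ExtResidue R (R ⧸ I) 0 →ₗ[ResidueField R] ExtResidue R I 1 where
  toFun e := e.comp (shortExact_ideal I).extClass (zero_add 1)
  map_add' := by simp
  map_smul' c e := by
    obtain ⟨r, rfl⟩ := residue_surjective c
    exact Ext.smul_comp e (shortExact_ideal I).extClass (zero_add 1) r

theorem connecting_apply (I : Ideal R) (e : ExtResidue R (R ⧸ I) 0) :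
    connecting I e = e.comp (shortExact_ideal I).extClass (zero_add 1) := rfl

theorem connecting_injective {x : R} (hxm : x ∈ maximalIdeal R) (hx : x ∈ nonZeroDivisors R)
    (I : Ideal R) : Function.Injective (connecting I) := by
  rw [injective_iff_map_eq_zero]
  intro e he
  obtain ⟨e', rfl⟩ := Ext.covariant_sequence_exact₃ _ (shortExact_ideal I) e (zero_add 1) he
  obtain ⟨f, rfl⟩ := Ext.homEquiv₀.symm.surjective e'
  have : f = 0 := by
    ext1
    exact linearMap_residueField_eq_zero hxm hx f.hom
  rw [this, Ext.homEquiv₀_symm_apply, Ext.mk₀_zero, Ext.zero_comp]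

theorem connecting_surjective_iff (I : Ideal R) : Function.Surjective (connecting I) ↔
    ∀ e : ExtResidue R I 1, e.comp (Ext.mk₀ (ModuleCat.ofHom I.subtype)) (add_zero 1) = 0 := by
  constructor
  · intro h e
    obtain ⟨e, rfl⟩ := h e
    rw [connecting_apply, Ext.comp_assoc_of_third_deg_zero]
    exact (congrArg (fun a => e.comp a (zero_add 1)) (shortExact_ideal I).extClass_comp).trans
      (Ext.comp_zero _ _ _ _ _)
  · intro h e
    exact Ext.covariant_sequence_exact₁ _ (shortExact_ideal I) e (h e) (zero_add 1)

/-- Since `x` kills `Ext^1(k, M)`, the connecting map `Hom(k, M/xM) → Ext^1(k, M)` is onto. -/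
theorem exists_hom_comp_extClass_eq {M : Type u} [AddCommGroup M] [Module R M] {x : R}
    (hxm : x ∈ maximalIdeal R) (hx : Function.Injective (LinearMap.lsmul R M x))
    (e : ExtResidue R M 1) :
    ∃ u : ResidueField R →ₗ[R] M ⧸ LinearMap.range (LinearMap.lsmul R M x),
      (Ext.mk₀ (ModuleCat.ofHom u)).comp (shortExact_smul hx).extClass (zero_add 1) = e := by
  have h0 : e.comp (Ext.mk₀ (ModuleCat.ofHom (LinearMap.lsmul R M x))) (add_zero 1) = 0 := by
    have : ModuleCat.ofHom (LinearMap.lsmul R M x) = x • 𝟙 (ModuleCat.of R M) := by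
      ext
      rfl
    rw [this, ← Ext.smul_eq_comp_mk₀, extResidue_smul_eq_zero hxm]
  obtain ⟨e', rfl⟩ := Ext.covariant_sequence_exact₁ _ (shortExact_smul hx) e h0 (zero_add 1)
  obtain ⟨u, rfl⟩ := Ext.homEquiv₀.symm.surjective e'
  exact ⟨u.hom, rfl⟩

/-- The map `Ext^1(k, I) → Ext^1(k, R)` sends the class of `u : k → I/xI` to the class of the
composite `k → I/xI → R/xR`, and `Hom(k, R/xR) → Ext^1(k, R)` is injective as `Hom(k, R) = 0`. -/
theorem extClass_comp_subtype_eq_zero_iff {x : R} (hxm : x ∈ maximalIdeal R)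
    (hx : x ∈ nonZeroDivisors R) (I : Ideal R)
    (u : ResidueField R →ₗ[R] I ⧸ LinearMap.range (LinearMap.lsmul R I x)) :
    ((Ext.mk₀ (ModuleCat.ofHom u)).comp (shortExact_smul (lsmul_ideal_injective hx I)).extClass
      (zero_add 1)).comp (Ext.mk₀ (ModuleCat.ofHom I.subtype)) (add_zero 1) = 0 ↔
    quotSMulToRing x I ∘ₗ u = 0 := by
  let φ : ModuleCat.shortComplexOfCompEqZero (LinearMap.lsmul R I x)
        (Submodule.mkQ (LinearMap.range (LinearMap.lsmul R I x)))
        (LinearMap.exact_map_mkQ_range _).linearMap_comp_eq_zero ⟶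
      ModuleCat.shortComplexOfCompEqZero (LinearMap.lsmul R R x)
        (Submodule.mkQ (LinearMap.range (LinearMap.lsmul R R x)))
        (LinearMap.exact_map_mkQ_range _).linearMap_comp_eq_zero :=
    { τ₁ := ModuleCat.ofHom I.subtype
      τ₂ := ModuleCat.ofHom I.subtype
      τ₃ := ModuleCat.ofHom (quotSMulToRing x I)
      comm₁₂ := by ext; rfl
      comm₂₃ := by ext; rfl }
  have hnat := ShortComplex.ShortExact.extClass_naturality
    (shortExact_smul (lsmul_ideal_injective hx I)) (shortExact_smul (lsmul_ring_injective hx)) φ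
  have hcomp : ((Ext.mk₀ (ModuleCat.ofHom u)).comp
      (shortExact_smul (lsmul_ideal_injective hx I)).extClass
      (zero_add 1)).comp (Ext.mk₀ (ModuleCat.ofHom I.subtype)) (add_zero 1) =
      (Ext.mk₀ (ModuleCat.ofHom (quotSMulToRing x I ∘ₗ u))).comp
        (shortExact_smul (lsmul_ring_injective hx)).extClass (zero_add 1) := by
    rw [Ext.comp_assoc_of_third_deg_zero]
    refine (congrArg (fun a => (Ext.mk₀ (ModuleCat.ofHom u)).comp a (zero_add 1)) hnat).trans ?_
    exact Ext.mk₀_comp_mk₀_assoc _ _ _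
  rw [hcomp]
  constructor
  · intro h
    obtain ⟨e, he⟩ := Ext.covariant_sequence_exact₃ _ (shortExact_smul (lsmul_ring_injective hx))
      _ (zero_add 1) h
    obtain ⟨f, rfl⟩ := Ext.homEquiv₀.symm.surjective e
    have hf : f = 0 := by
      ext1
      exact linearMap_residueField_eq_zero hxm hx f.hom
    rw [hf, Ext.homEquiv₀_symm_apply, Ext.mk₀_zero, Ext.zero_comp] at he
    exact congrArg ModuleCat.Hom.hom ((Ext.mk₀_eq_zero_iff _).mp he.symm)
  · intro h
    rw [h]
    exact (congrArg (fun a => Ext.comp a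
      (shortExact_smul (lsmul_ring_injective hx)).extClass (zero_add 1)) (Ext.mk₀_zero _ _)).trans
      (Ext.zero_comp _ _ _ _ _)

theorem mem_of_mem_colonMax_span_mul {x : R} (hxm : x ∈ maximalIdeal R)
    (hx : x ∈ nonZeroDivisors R) {I : Ideal R} {r : R}
    (hr : r ∈ colonMax (Ideal.span {x} * I)) : r ∈ I := by
  obtain ⟨i, hi, h⟩ := Ideal.mem_span_singleton_mul.mp (mem_colonMax.mp hr x hxm)
  rw [mul_comm r x] at h
  exact (mul_cancel_left_mem_nonZeroDivisors hx).mp h ▸ hi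

theorem connecting_surjective_iff_colonMax_le {x : R} (hxm : x ∈ maximalIdeal R)
    (hx : x ∈ nonZeroDivisors R) (I : Ideal R) : Function.Surjective (connecting I) ↔
      colonMax (Ideal.span {x} * I) ≤ Ideal.span {x} := by
  rw [connecting_surjective_iff]
  constructor
  · intro h r hr
    have hrI := mem_of_mem_colonMax_span_mul hxm hx hr
    -- The element `r` defines the linear map `k → I/xI` sending `1` to the class of `r`.
    let v : R →ₗ[R] I ⧸ LinearMap.range (LinearMap.lsmul R I x) :=
      LinearMap.toSpanSingleton R _ (Submodule.mkQ _ ⟨r, hrI⟩)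
    have hv : maximalIdeal R ≤ LinearMap.ker v := by
      intro y hy
      obtain ⟨i, hi, hxi⟩ := Ideal.mem_span_singleton_mul.mp (mem_colonMax.mp hr y hy)
      rw [LinearMap.mem_ker, LinearMap.toSpanSingleton_apply, ← map_smul, Submodule.mkQ_apply,
        Submodule.Quotient.mk_eq_zero]
      exact ⟨⟨i, hi⟩, Subtype.ext (hxi.trans (mul_comm _ _))⟩
    let w : ResidueField R →ₗ[R] I ⧸ LinearMap.range (LinearMap.lsmul R I x) :=
      Submodule.liftQ (maximalIdeal R) v hv
    have hw : w (residue R 1) = Submodule.mkQ _ ⟨r, hrI⟩ :=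
      (Submodule.liftQ_apply (maximalIdeal R) v 1).trans (one_smul _ _)
    have h0 := (extClass_comp_subtype_eq_zero_iff hxm hx I w).mp (h _)
    rw [← quotSMulToRing_mk_eq_zero_iff (I := I) ⟨r, hrI⟩, ← hw]
    exact LinearMap.congr_fun h0 (residue R 1)
  · intro h e
    obtain ⟨w, rfl⟩ := exists_hom_comp_extClass_eq hxm (lsmul_ideal_injective hx I) e
    rw [extClass_comp_subtype_eq_zero_iff hxm hx]
    refine residueField_linearMap_ext ?_
    obtain ⟨⟨i, hi⟩, hic⟩ := Submodule.mkQ_surjective _ (w 1)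
    change quotSMulToRing x I (w 1) = 0
    rw [← hic, quotSMulToRing_mk_eq_zero_iff]
    refine h (mem_colonMax.mpr fun y hy => ?_)
    have hy1 : y • w 1 = 0 := by
      rw [← map_smul, smul_one_residueField_eq_zero hy, map_zero]
    rw [← hic, ← map_smul, Submodule.mkQ_apply, Submodule.Quotient.mk_eq_zero] at hy1
    obtain ⟨j, hj⟩ := hy1
    refine Ideal.mem_span_singleton_mul.mpr ⟨j, j.2, ?_⟩
    exact (congrArg Subtype.val hj).trans (mul_comm _ _)

theorem cmType_ideal_eq_rank (hdim : ringKrullDim R = 1) {I : Ideal R}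
    (hI : ∃ y ∈ I, y ∈ nonZeroDivisors R) :
    cmType R I = Module.rank (ResidueField R) (ExtResidue R I 1) := by
  rw [cmType, moduleDim_ideal hdim hI]

theorem cmType_quotient_eq_rank (hdim : ringKrullDim R = 1) {I : Ideal R} (hne : I ≠ ⊤)
    (hI : ∃ y ∈ I, y ∈ nonZeroDivisors R) :
    cmType R (R ⧸ I) = Module.rank (ResidueField R) (ExtResidue R (R ⧸ I) 0) := by
  rw [cmType, moduleDim_quotient hdim hne hI]

theorem cmType_quotient_le (hdim : ringKrullDim R = 1) {x : R} (hxm : x ∈ maximalIdeal R)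
    (hx : x ∈ nonZeroDivisors R) {I : Ideal R} (hne : I ≠ ⊤)
    (hI : ∃ y ∈ I, y ∈ nonZeroDivisors R) : cmType R (R ⧸ I) ≤ cmType R I := by
  rw [cmType_ideal_eq_rank hdim hI, cmType_quotient_eq_rank hdim hne hI]
  exact LinearMap.rank_le_of_injective _ (connecting_injective hxm hx I)

theorem cmType_eq_iff_colonMax_le [IsNoetherianRing R] (hdim : ringKrullDim R = 1) {x : R}
    (hxm : x ∈ maximalIdeal R) (hx : x ∈ nonZeroDivisors R) {I : Ideal R} (hne : I ≠ ⊤)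
    (hI : ∃ y ∈ I, y ∈ nonZeroDivisors R) : cmType R I = cmType R (R ⧸ I) ↔
      colonMax (Ideal.span {x} * I) ≤ Ideal.span {x} := by
  rw [← connecting_surjective_iff_colonMax_le hxm hx, cmType_ideal_eq_rank hdim hI,
    cmType_quotient_eq_rank hdim hne hI]
  have hinj := connecting_injective hxm hx I
  have : Module.Finite (ResidueField R) (ExtResidue R I 1) :=
    Module.Finite.of_restrictScalars_finite R _ _
  have : Module.Finite (ResidueField R) (ExtResidue R (R ⧸ I) 0) :=
    Module.Finite.of_restrictScalars_finite R _ _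
  constructor
  · intro h
    exact (LinearMap.injective_iff_surjective_of_finrank_eq_finrank
      (congrArg Cardinal.toNat h.symm)).mp hinj
  · intro h
    exact (LinearEquiv.ofBijective _ ⟨hinj, h⟩).rank_eq.symm

end TypeComparison

/-! ### Colons by the maximal ideal -/

section Colon

variable {R : Type u} [CommRing R] [IsLocalRing R]

theorem colonMax_le_iff_eq {x : R} (hx : x ∈ nonZeroDivisors R) (I : Ideal R) :
    colonMax (Ideal.span {x} * I) ≤ Ideal.span {x} ↔
      colonMax (Ideal.span {x} * I) = Ideal.span {x} * colonMax I := by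
  refine ⟨fun h => le_antisymm (fun r hr => ?_) (fun r hr => ?_), fun h => h ▸ Ideal.mul_le_left⟩
  · obtain ⟨z, rfl⟩ := Ideal.mem_span_singleton.mp (h hr)
    refine Ideal.mem_span_singleton_mul.mpr ⟨z, mem_colonMax.mpr fun y hy => ?_, rfl⟩
    obtain ⟨i, hi, hxi⟩ := Ideal.mem_span_singleton_mul.mp (mem_colonMax.mp hr y hy)
    rw [mul_assoc] at hxi
    exact (mul_cancel_left_mem_nonZeroDivisors hx).mp hxi ▸ hi
  · obtain ⟨z, hz, rfl⟩ := Ideal.mem_span_singleton_mul.mp hr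
    exact mem_colonMax.mpr fun y hy => Ideal.mem_span_singleton_mul.mpr
      ⟨z * y, mem_colonMax.mp hz y hy, (mul_assoc _ _ _).symm⟩

/-- Division by `x` identifies `xI : 𝔪` with `I :_Q 𝔪`. -/
theorem colonMax_le_iff_colonIn_subset (Q : Type v) [CommRing Q] [Algebra R Q]
    [IsFractionRing R Q] {x : R} (hxm : x ∈ maximalIdeal R) (hx : x ∈ nonZeroDivisors R)
    (I : Ideal R) : colonMax (Ideal.span {x} * I) ≤ Ideal.span {x} ↔
      ((colonIn Q I (maximalIdeal R) : Submodule R Q) : Set Q) ⊆ Set.range (algebraMap R Q) := by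
  have hinj := IsFractionRing.injective R Q
  have hu : IsUnit (algebraMap R Q x) := IsLocalization.map_units Q ⟨x, hx⟩
  constructor
  · intro h q hq
    have hq := (mem_colonIn Q).mp hq
    obtain ⟨i, -, hiq⟩ := hq x hxm
    have hi : i ∈ colonMax (Ideal.span {x} * I) := mem_colonMax.mpr fun w hw => by
      obtain ⟨j, hj, hjq⟩ := hq w hw
      refine Ideal.mem_span_singleton_mul.mpr ⟨j, hj, hinj ?_⟩
      rw [map_mul, map_mul, hjq, hiq]
      ring
    obtain ⟨z, rfl⟩ := Ideal.mem_span_singleton.mp (h hi)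
    refine ⟨z, hu.mul_left_cancel ?_⟩
    rw [← map_mul, hiq, mul_comm]
  · intro h r hr
    have hmk : algebraMap R Q x * IsLocalization.mk' Q r ⟨x, hx⟩ = algebraMap R Q r :=
      IsLocalization.mk'_spec' Q r ⟨x, hx⟩
    have hq : IsLocalization.mk' Q r ⟨x, hx⟩ ∈ colonIn Q I (maximalIdeal R) :=
      (mem_colonIn Q).mpr fun w hw => by
        obtain ⟨j, hj, hjr⟩ := Ideal.mem_span_singleton_mul.mp (mem_colonMax.mp hr w hw)
        refine ⟨j, hj, hu.mul_left_cancel ?_⟩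
        rw [← mul_assoc, hmk, ← map_mul, ← map_mul, hjr]
    obtain ⟨z, hz⟩ := h hq
    refine Ideal.mem_span_singleton.mpr ⟨z, hinj ?_⟩
    rw [map_mul, hz, hmk]

end Colon

/-! ### Duality with respect to a canonical ideal -/

section Duality

variable {R : Type u} [CommRing R] (Q : Type v) [CommRing Q] [Algebra R Q] [IsFractionRing R Q]

/-- A linear map between ideals whose source contains a nonzerodivisor is multiplication by an
element of the total ring of fractions. -/
theorem exists_eq_mul_of_linearMap {A K : Ideal R} (hA : ∃ y ∈ A, y ∈ nonZeroDivisors R)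
    (f : A →ₗ[R] K) : ∃ q : Q, ∀ a : A, algebraMap R Q (f a) = q * algebraMap R Q a := by
  obtain ⟨y, hyA, hy⟩ := hA
  have hu : IsUnit (algebraMap R Q y) := IsLocalization.map_units Q ⟨y, hy⟩
  refine ⟨IsLocalization.mk' Q (f ⟨y, hyA⟩ : R) ⟨y, hy⟩, fun a => hu.mul_left_cancel ?_⟩
  have hmk : algebraMap R Q y * IsLocalization.mk' Q (f ⟨y, hyA⟩ : R) ⟨y, hy⟩ =
      algebraMap R Q (f ⟨y, hyA⟩) := IsLocalization.mk'_spec' Q _ ⟨y, hy⟩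
  rw [← mul_assoc, hmk, ← map_mul, ← map_mul]
  have h : y • f a = (a : R) • f ⟨y, hyA⟩ := by
    rw [← map_smul, ← map_smul]
    congr 1
    exact Subtype.ext (mul_comm _ _)
  congr 1
  rw [mul_comm _ (a : R)]
  exact congrArg Subtype.val h

theorem exists_linearMap_of_mem_colonIn {B K : Ideal R} {q : Q} (hq : q ∈ colonIn Q K B) :
    ∃ g : B →ₗ[R] K, ∀ b : B, algebraMap R Q (g b) = q * algebraMap R Q b := by
  choose! g hgK hg using (mem_colonIn Q).mp hq
  have hinj := IsFractionRing.injective R Q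
  refine ⟨⟨⟨fun b => ⟨g b, hgK b b.2⟩, fun a b => Subtype.ext (hinj ?_)⟩,
    fun r b => Subtype.ext (hinj ?_)⟩, fun b => hg b b.2⟩
  · simp only [Submodule.coe_add, map_add]
    rw [hg _ (B.add_mem a.2 b.2), hg _ a.2, hg _ b.2, map_add, mul_add]
  · simp only [SetLike.val_smul, smul_eq_mul, RingHom.id_apply, map_mul]
    rw [hg _ (B.mul_mem_left r b.2), hg _ b.2, map_mul]
    ring

/-- `K` detects inclusions of ideals: if every `q` with `qA ⊆ K` satisfies `qB ⊆ K`, where `A ⊆ B`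
are ideals and `A` contains a nonzerodivisor, then `A = B`. -/
def DetectsInclusions (K : Ideal R) : Prop :=
  ∀ ⦃A B : Ideal R⦄, A ≤ B → (∃ y ∈ A, y ∈ nonZeroDivisors R) →
    colonIn Q K A ≤ colonIn Q K B → A = B

theorem IsCanonicalIdeal.detectsInclusions [IsLocalRing R] [IsNoetherianRing R]
    (hdim : ringKrullDim R = 1) (hx : ∃ x ∈ maximalIdeal R, x ∈ nonZeroDivisors R) {K : Ideal R}
    (hK : IsCanonicalIdeal K) : DetectsInclusions Q K := by
  obtain ⟨hCM, htype, hinj⟩ := hK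
  have hk : Nontrivial (ExtResidue R K 1) := by
    rw [cmType, hCM.moduleDim_eq_one hdim] at htype
    exact rank_pos_iff_nontrivial.mp (htype ▸ one_pos)
  intro A B hAB hA hcolon
  by_contra hne
  obtain ⟨f, hf⟩ := exists_linearMap_not_extending hdim hx K hinj hk (lt_of_le_of_ne hAB hne) hA
  obtain ⟨q, hq⟩ := exists_eq_mul_of_linearMap Q hA f
  have hqA : q ∈ colonIn Q K A := (mem_colonIn Q).mpr fun a ha => ⟨f ⟨a, ha⟩, (f _).2, hq ⟨a, ha⟩⟩
  obtain ⟨g, hg⟩ := exists_linearMap_of_mem_colonIn Q (hcolon hqA)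
  refine hf g (LinearMap.ext fun a => Subtype.ext (IsFractionRing.injective R Q ?_))
  rw [hq]
  exact hg _

variable {Q}

/-- An ideal `K` detecting inclusions is faithful, hence contains a nonzerodivisor: if `aK = 0`,
then `q x ^ n ∈ K` forces `q a = 0`, so that `K :_Q (x ^ n) = K :_Q (x ^ n, a)` and thus
`a ∈ (x ^ n)` for all `n`. -/
theorem DetectsInclusions.exists_mem_nonZeroDivisors [IsLocalRing R] [IsNoetherianRing R]
    (hx : ∃ x ∈ maximalIdeal R, x ∈ nonZeroDivisors R) {K : Ideal R}
    (hK : DetectsInclusions Q K) : ∃ y ∈ K, y ∈ nonZeroDivisors R := by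
  obtain ⟨x, hxm, hx⟩ := hx
  by_contra! hno
  obtain ⟨-, a, ha, ha0⟩ := SetLike.lt_iff_le_and_exists.mp
    (Ideal.bot_lt_annihilator_of_disjoint_nonZeroDivisors (I := K)
      (Set.disjoint_left.mpr hno))
  have haK : ∀ z ∈ K, a * z = 0 := fun z hz => Submodule.mem_annihilator.mp ha z hz
  refine ha0 ?_
  rw [← Ideal.iInf_pow_eq_bot_of_isLocalRing (Ideal.span {x})
    (by simpa [Ideal.span_singleton_eq_top] using hxm), Submodule.mem_iInf]
  intro n
  rw [Ideal.span_singleton_pow]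
  have hxn : x ^ n ∈ nonZeroDivisors R := pow_mem hx n
  have hu : IsUnit (algebraMap R Q (x ^ n)) := IsLocalization.map_units Q ⟨x ^ n, hxn⟩
  have hAB : Ideal.span {x ^ n} = Ideal.span {x ^ n} ⊔ Ideal.span {a} := by
    refine hK le_sup_left ⟨x ^ n, Ideal.mem_span_singleton_self _, hxn⟩ fun q hq => ?_
    have hq := (mem_colonIn Q).mp hq
    have hqa : q * algebraMap R Q a = 0 := by
      obtain ⟨z, hz, hzq⟩ := hq _ (Ideal.mem_span_singleton_self _)
      refine hu.mul_left_cancel ?_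
      rw [mul_zero, ← mul_assoc, mul_comm _ q, ← hzq, ← map_mul, mul_comm z, haK z hz, map_zero]
    refine (mem_colonIn Q).mpr fun b hb => ?_
    obtain ⟨b₁, hb₁, b₂, hb₂, rfl⟩ := Submodule.mem_sup.mp hb
    obtain ⟨s, rfl⟩ := Ideal.mem_span_singleton.mp hb₂
    obtain ⟨z, hz, hzq⟩ := hq b₁ hb₁
    refine ⟨z, hz, ?_⟩
    rw [map_add, map_mul, mul_add, ← mul_assoc, hqa, zero_mul, add_zero, hzq]
  rw [hAB]
  exact Ideal.mem_sup_right (Ideal.mem_span_singleton_self a)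

/-- The double dual `K : (K : J)` of a fractional ideal `J` containing a nonzerodivisor is `J`. -/
theorem DetectsInclusions.div_div_le {K : Ideal R} (hK : DetectsInclusions Q K)
    (J : Submodule R Q) (hJ : ∃ y ∈ nonZeroDivisors R, algebraMap R Q y ∈ J)
    (hJ' : ∃ c ∈ nonZeroDivisors R, ∀ j ∈ J, algebraMap R Q c * j ∈ (1 : Submodule R Q)) :
    IsLocalization.coeSubmodule Q K / (IsLocalization.coeSubmodule Q K / J) ≤ J := by
  intro p hp
  obtain ⟨y, hy, hyJ⟩ := hJ
  obtain ⟨c, hc, hcJ⟩ := hJ'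
  obtain ⟨r, s, rfl⟩ := IsLocalization.exists_mk'_eq (nonZeroDivisors R) p
  set p := IsLocalization.mk' Q r s with hpdef
  -- After multiplication by `d`, both `J` and `J + Rp` become ideals `A ⊆ B` of `R`.
  set d : R := c * s with hd
  have hdu : IsUnit (algebraMap R Q d) := IsLocalization.map_units Q ⟨d, mul_mem hc s.2⟩
  have hdJ : ∀ j ∈ J, ∃ a : R, algebraMap R Q a = algebraMap R Q d * j := by
    intro j hj
    obtain ⟨a, ha⟩ := Submodule.mem_one.mp (hcJ j hj)
    refine ⟨s * a, ?_⟩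
    rw [map_mul, ha, hd, map_mul]
    ring
  have hdp : algebraMap R Q d * p = algebraMap R Q (c * r) := by
    rw [hd, map_mul, mul_assoc, IsLocalization.mk'_spec', map_mul]
  let A : Ideal R :=
    (J.map (LinearMap.mulLeft R (algebraMap R Q d))).comap (Algebra.linearMap R Q)
  have hA : ∀ {a : R}, a ∈ A ↔ ∃ j ∈ J, algebraMap R Q d * j = algebraMap R Q a := Iff.rfl
  have hAB : A = A ⊔ Ideal.span {c * r} := by
    refine hK le_sup_left ⟨d * y, hA.mpr ⟨_, hyJ, (map_mul _ _ _).symm⟩,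
      mul_mem (mul_mem hc s.2) hy⟩ fun q hq => ?_
    have hq := (mem_colonIn Q).mp hq
    have hqd : q * algebraMap R Q d ∈ IsLocalization.coeSubmodule Q K / J := by
      refine Submodule.mem_div_iff_forall_mul_mem.mpr fun j hj => ?_
      obtain ⟨a, ha⟩ := hdJ j hj
      obtain ⟨z, hz, hzq⟩ := hq a (hA.mpr ⟨j, hj, ha.symm⟩)
      exact (IsLocalization.mem_coeSubmodule Q K).mpr ⟨z, hz, by rw [hzq, ha, mul_assoc]⟩
    obtain ⟨w, hw, hwq⟩ := (IsLocalization.mem_coeSubmodule Q K).mp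
      (Submodule.mem_div_iff_forall_mul_mem.mp hp _ hqd)
    refine (mem_colonIn Q).mpr fun b hb => ?_
    obtain ⟨b₁, hb₁, b₂, hb₂, rfl⟩ := Submodule.mem_sup.mp hb
    obtain ⟨t, rfl⟩ := Ideal.mem_span_singleton.mp hb₂
    obtain ⟨z, hz, hzq⟩ := hq b₁ hb₁
    refine ⟨z + w * t, K.add_mem hz (K.mul_mem_right _ hw), ?_⟩
    rw [map_add, map_add, hzq, map_mul, hwq, map_mul _ (c * r), ← hdp]
    ring
  have hcr : c * r ∈ A := hAB ▸ Ideal.mem_sup_right (Ideal.mem_span_singleton_self _)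
  obtain ⟨j, hj, hjp⟩ := hA.mp hcr
  rw [← hdp] at hjp
  exact hdu.mul_left_cancel hjp ▸ hj

theorem DetectsInclusions.coeSubmodule_le_iff [IsLocalRing R] [IsNoetherianRing R]
    (hx : ∃ x ∈ maximalIdeal R, x ∈ nonZeroDivisors R) {K : Ideal R}
    (hK : DetectsInclusions Q K) {I : Ideal R} (hI : ∃ y ∈ I, y ∈ nonZeroDivisors R) :
    IsLocalization.coeSubmodule Q K ≤ maximalIdeal R • colonIn Q K I ↔
      ((colonIn Q I (maximalIdeal R) : Submodule R Q) : Set Q) ⊆ Set.range (algebraMap R Q) := by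
  obtain ⟨k, hkK, hk⟩ := hK.exists_mem_nonZeroDivisors hx
  obtain ⟨y, hyI, hy⟩ := hI
  obtain ⟨x, hxm, hx⟩ := hx
  have hone : ∀ r : R, algebraMap R Q r ∈ (1 : Submodule R Q) :=
    fun r => Submodule.mem_one.mpr ⟨r, rfl⟩
  constructor
  · -- If `q𝔪 ⊆ I`, then `qK ⊆ q𝔪(K : I) ⊆ K`, so that `q` lies in `K : K = K : (K : R) = R`.
    intro h q hq
    have hq := (mem_colonIn Q).mp hq
    refine Submodule.mem_one.mp (hK.div_div_le 1 ⟨1, one_mem _, hone 1⟩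
      ⟨1, one_mem _, fun j hj => by rwa [map_one, one_mul]⟩ ?_)
    refine Submodule.mem_div_iff_forall_mul_mem.mpr fun s hs => ?_
    have hsK : s ∈ IsLocalization.coeSubmodule Q K := by
      have := Submodule.mem_div_iff_forall_mul_mem.mp hs 1 (Submodule.one_le.mp le_rfl)
      rwa [mul_one] at this
    refine Submodule.smul_induction_on (p := fun s => q * s ∈ IsLocalization.coeSubmodule Q K)
      (h hsK) (fun w hw c hc => ?_) (fun a b ha hb => by
        rw [mul_add]
        exact add_mem ha hb)
    obtain ⟨i, hi, hiq⟩ := hq w hw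
    obtain ⟨z, hz, hzc⟩ := (mem_colonIn Q).mp hc i hi
    refine (IsLocalization.mem_coeSubmodule Q K).mpr ⟨z, hz, ?_⟩
    rw [hzc, hiq, Algebra.smul_def]
    ring
  · -- If `q` multiplies `𝔪(K : I)` into `K`, then `q𝔪 ⊆ K : (K : I) = I`, so that `q ∈ R`. Hence
    -- `K` lies in the double dual of `𝔪(K : I)`.
    intro h
    refine le_trans ?_ (hK.div_div_le (maximalIdeal R • colonIn Q K I) ⟨x * k, mul_mem hx hk, ?_⟩
      ⟨y, hy, fun j hj => ?_⟩)
    · intro s hs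
      obtain ⟨z, hz, rfl⟩ := (IsLocalization.mem_coeSubmodule Q K).mp hs
      refine Submodule.mem_div_iff_forall_mul_mem.mpr fun q hq => ?_
      have hqI : q ∈ colonIn Q I (maximalIdeal R) := by
        refine (mem_colonIn Q).mpr fun w hw => (IsLocalization.mem_coeSubmodule Q I).mp ?_
        refine hK.div_div_le _ ⟨y, hy, (IsLocalization.mem_coeSubmodule Q I).mpr ⟨y, hyI, rfl⟩⟩
          ⟨1, one_mem _, fun j hj => ?_⟩ (Submodule.mem_div_iff_forall_mul_mem.mpr fun c hc => ?_)
        · obtain ⟨i, -, rfl⟩ := (IsLocalization.mem_coeSubmodule Q I).mp hj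
          rw [← map_mul]
          exact hone _
        · have := Submodule.mem_div_iff_forall_mul_mem.mp hq _ (Submodule.smul_mem_smul hw hc)
          rwa [Algebra.smul_def, ← mul_assoc] at this
      obtain ⟨r, rfl⟩ := h hqI
      exact (IsLocalization.mem_coeSubmodule Q K).mpr
        ⟨z * r, K.mul_mem_right _ hz, map_mul _ _ _⟩
    · rw [map_mul, ← Algebra.smul_def]
      exact Submodule.smul_mem_smul hxm
        ((mem_colonIn Q).mpr fun i _ => ⟨k * i, K.mul_mem_right _ hkK, map_mul _ _ _⟩)
    · obtain ⟨z, -, hz⟩ := (mem_colonIn Q).mp (Submodule.smul_le_right hj) y hyI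
      rw [mul_comm, ← hz]
      exact hone z

end Duality

end EliasIdeals

/-! ### The equivalences -/

open EliasIdeals in
theorem theorem1p2 {R : Type u} [CommRing R] [IsLocalRing R]
    (hCM : IsCMLocalRing R) (hdim : ringKrullDim R = 1)
    (Q : Type v) [CommRing Q] [Algebra R Q] [IsFractionRing R Q]
    (I : Ideal R) (hI : IsMaximalPrimary I) :
    cmType R (R ⧸ I) ≤ cmType R I ∧
    List.TFAE [
      cmType R I = cmType R (R ⧸ I),
      ∀ x ∈ maximalIdeal R, x ∈ nonZeroDivisors R →
        colonMax (Ideal.span {x} * I) ≤ Ideal.span {x},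
      ∀ x ∈ maximalIdeal R, x ∈ nonZeroDivisors R →
        colonMax (Ideal.span {x} * I) = Ideal.span {x} * colonMax I,
      ∃ x ∈ maximalIdeal R, x ∈ nonZeroDivisors R ∧
        colonMax (Ideal.span {x} * I) ≤ Ideal.span {x},
      ∃ x ∈ maximalIdeal R, x ∈ nonZeroDivisors R ∧
        colonMax (Ideal.span {x} * I) = Ideal.span {x} * colonMax I,
      ((colonIn Q I (maximalIdeal R) : Submodule R Q) : Set Q) ⊆ Set.range (algebraMap R Q)] ∧
    ∀ K : Ideal R, IsCanonicalIdeal K →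
      (cmType R I = cmType R (R ⧸ I) ↔
        IsLocalization.coeSubmodule Q K ≤ maximalIdeal R • colonIn Q K I) := by
  have hNoeth : IsNoetherianRing R := hCM.2.1
  have hx' := hCM.exists_mem_nonZeroDivisors hdim
  have hIreg := hI.exists_mem_nonZeroDivisors hx'
  have hne : I ≠ ⊤ := hI.1.ne_top
  obtain ⟨x, hxm, hx⟩ := hx'
  have h12 {z : R} (hzm : z ∈ maximalIdeal R) (hz : z ∈ nonZeroDivisors R) :=
    cmType_eq_iff_colonMax_le hdim hzm hz hne hIreg
  have h16 := (h12 hxm hx).trans (colonMax_le_iff_colonIn_subset Q hxm hx I)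
  refine ⟨cmType_quotient_le hdim hxm hx hne hIreg, ?_, fun K hK => ?_⟩
  · tfae_have 1 → 2 := fun h z hzm hz => (h12 hzm hz).mp h
    tfae_have 2 → 3 := fun h z hzm hz => (colonMax_le_iff_eq hz I).mp (h z hzm hz)
    tfae_have 3 → 5 := fun h => ⟨x, hxm, hx, h x hxm hx⟩
    tfae_have 5 → 4 := fun ⟨z, hzm, hz, h⟩ => ⟨z, hzm, hz, (colonMax_le_iff_eq hz I).mpr h⟩
    tfae_have 4 → 1 := fun ⟨z, hzm, hz, h⟩ => (h12 hzm hz).mpr h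
    tfae_have 1 ↔ 6 := h16
    tfae_finish
  · exact h16.trans (((hK.detectsInclusions Q hdim ⟨x, hxm, hx⟩).coeSubmodule_le_iff
      ⟨x, hxm, hx⟩ hIreg).symm)
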